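/- Let $n\in\mathbb{N}$, let $g\colon\mathbb{R}^n\to\mathbb{R}$, $g(x_1,\dots,x_n)=a_1x_1+\dots+a_nx_n+b$, be a linear (that is, affine) function with real coefficients that is monotone (i.e. $g(x)\le g(y)$ whenever $x_j\le y_j$ for all $j$), and let $P\subset\mathbb{R}$ be finite. Let $\mathcal{F}=\mathcal{F}(\{g\},P)\subset\mathbb{R}$ be the inclusion-least set such that $P\subseteq\mathcal{F}$, and such that $g(x_1,\dots,x_n)\in\mathcal{F}$ whenever $x_1,\dots,x_n\in\mathcal{F}$ and $g(x_1,\dots,x_n)>x_i$ for every $i$. Then there exists an algorithm deciding whether a given $x\in\mathbb{R}$ belongs to the closure $\overline{\mathcal{F}}$ or not. Here the model of computation over the reals is $\Sigma$-definability in the structure $\mathbb{HF}(\mathbb{R},0,1,+,\times)$ of hereditarily finite sets over the real numbers as urelements, with equality, the membership relation, a predicate for being a real number, and the constants and operations of $\mathbb{R}$ given by their graphs. The $\Delta_0$-formulas are built from atomic formulas by propositional connectives and the bounded quantifiers $\forall z\in t$, $\exists z\in t$; the $\Sigma$-formulas are built from $\Delta_0$-formulas by $\wedge$, $\vee$, bounded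 quantifiers and unbounded existential quantifiers. An algorithm deciding $\overline{\mathcal{F}}$ exists in the sense that both $\overline{\mathcal{F}}$ and $\mathbb{R}\setminus\overline{\mathcal{F}}$ are definable, as subsets of $\mathbb{R}$, by $\Sigma$-formulas in this structure whose only parameters are the coefficients $a_1,\dots,a_n,b$ of $g$ and the elements of $P$. -/

import Mathlib

/-- Codes for hereditarily finite sets over a set `α` of urelements: a code is an urelement or a
finite list of codes. -/
inductive PreHF (α : Type) : Type
  | atom (a : α) : PreHF α
  | node (n : ℕ) (f : Fin n → PreHF α) : PreHF α

namespace PreHF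

variable {α : Type}

/-- Extensional equality of codes. -/
def Equiv : PreHF α → PreHF α → Prop
  | atom a, atom b => a = b
  | node _ f, node _ g => (∀ i, ∃ j, Equiv (f i) (g j)) ∧ ∀ j, ∃ i, Equiv (f i) (g j)
  | atom _, node _ _ => False
  | node _ _, atom _ => False

theorem Equiv.refl (x : PreHF α) : Equiv x x := by
  induction x with
  | atom a => simp [Equiv]
  | node n f ih => exact ⟨fun i => ⟨i, ih i⟩, fun i => ⟨i, ih i⟩⟩

theorem Equiv.symm {x y : PreHF α} (h : Equiv x y) : Equiv y x := by
  induction x generalizing y with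
  | atom a =>
    cases y with
    | atom b => simpa [Equiv] using Eq.symm h
    | node n g => exact h.elim
  | node m f ih =>
    cases y with
    | atom b => exact h.elim
    | node n g =>
      refine ⟨fun j => ?_, fun i => ?_⟩
      · obtain ⟨i, hi⟩ := h.2 j
        exact ⟨i, ih i hi⟩
      · obtain ⟨j, hj⟩ := h.1 i
        exact ⟨j, ih i hj⟩

theorem Equiv.trans {x y z : PreHF α} (h : Equiv x y) (k : Equiv y z) : Equiv x z := by
  induction x generalizing y z with
  | atom a =>
    cases y with
    | atom b =>
      cases z with
      | atom c => exact Eq.trans (show a = b from h) k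
      | node n g => exact k.elim
    | node n g => exact h.elim
  | node m f ih =>
    cases y with
    | atom b => exact h.elim
    | node n g =>
      cases z with
      | atom c => exact k.elim
      | node l e =>
        refine ⟨fun i => ?_, fun j => ?_⟩
        · obtain ⟨j, hj⟩ := h.1 i
          obtain ⟨t, ht⟩ := k.1 j
          exact ⟨t, ih i hj ht⟩
        · obtain ⟨t, ht⟩ := k.2 j
          obtain ⟨i, hi⟩ := h.2 t
          exact ⟨i, ih i hi ht⟩

instance setoid (α : Type) : Setoid (PreHF α) :=
  ⟨Equiv, Equiv.refl, Equiv.symm, Equiv.trans⟩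

/-- Membership of codes; urelements have no members. -/
def Mem (x : PreHF α) : PreHF α → Prop
  | atom _ => False
  | node _ f => ∃ i, Equiv x (f i)

/-- A code denotes an urelement. -/
def IsAtom : PreHF α → Prop
  | atom _ => True
  | node _ _ => False

theorem mem_of_equiv {x x' y y' : PreHF α} (hx : Equiv x x') (hy : Equiv y y') (h : Mem x y) :
    Mem x' y' := by
  cases y with
  | atom a => exact h.elim
  | node n f =>
    cases y' with
    | atom a => exact hy.elim
    | node m g =>
      obtain ⟨i, hi⟩ := h
      obtain ⟨j, hj⟩ := hy.1 i
      exact ⟨j, (hx.symm.trans hi).trans hj⟩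

end PreHF

/-- `HF α` is the universe of hereditarily finite sets over the set `α` of urelements: it consists
of the elements of `α` and of all finite sets of elements of `HF α`. -/
def HF (α : Type) : Type := Quotient (PreHF.setoid α)

namespace HF

variable {α : Type}

/-- An element of `α` as an urelement. -/
def atom (a : α) : HF α := Quotient.mk (PreHF.setoid α) (PreHF.atom a)

/-- The membership relation of `HF α`. -/
def Mem (x y : HF α) : Prop :=
  Quotient.liftOn₂ x y PreHF.Mem fun _ _ _ _ hx hy =>
    propext ⟨PreHF.mem_of_equiv hx hy,
      PreHF.mem_of_equiv (PreHF.Equiv.symm hx) (PreHF.Equiv.symm hy)⟩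

/-- The relation symbols of the structure `HF(ℝ, 0, 1, +, ×)`; the operations of `ℝ` enter through
their graphs, and equality is a logical symbol. -/
inductive Rel : ℕ → Type
  | isReal : Rel 1
  | isZero : Rel 1
  | isOne : Rel 1
  | mem : Rel 2
  | add : Rel 3
  | mul : Rel 3

/-- The first-order language of the structure `HF(ℝ, 0, 1, +, ×)`. -/
def lang : FirstOrder.Language.{0, 0} := ⟨fun _ => Empty, Rel⟩

/-- The structure `HF(ℝ, 0, 1, +, ×)`. -/
instance realStructure : lang.Structure (HF ℝ) where
  funMap := fun f _ => Empty.elim f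
  RelMap := fun r v =>
    match r, v with
    | .isReal, v => ∃ x : ℝ, v 0 = atom x
    | .isZero, v => v 0 = atom (0 : ℝ)
    | .isOne, v => v 0 = atom (1 : ℝ)
    | .mem, v => Mem (v 0) (v 1)
    | .add, v => ∃ x y : ℝ, v 0 = atom x ∧ v 1 = atom y ∧ v 2 = atom (x + y)
    | .mul, v => ∃ x y : ℝ, v 0 = atom x ∧ v 1 = atom y ∧ v 2 = atom (x * y)

/-- The formula `z ∈ t`, where `z` is the quantifier variable number `n` and where `t` is a term
in the earlier variables. -/
def memLast {β : Type} {n : ℕ} (t : lang.Term (β ⊕ Fin n)) : lang.BoundedFormula β (n + 1) :=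
  FirstOrder.Language.Relations.boundedFormula₂ (L := lang) Rel.mem
    (FirstOrder.Language.Term.var (Sum.inr (Fin.last n)))
    (t.relabel (Sum.map id Fin.castSucc))

/-- The bounded quantification `∀ z ∈ t, φ`. -/
def ballMem {β : Type} {n : ℕ} (t : lang.Term (β ⊕ Fin n)) (φ : lang.BoundedFormula β (n + 1)) :
    lang.BoundedFormula β n :=
  ((memLast t).imp φ).all

/-- The bounded quantification `∃ z ∈ t, φ`. -/
def bexMem {β : Type} {n : ℕ} (t : lang.Term (β ⊕ Fin n)) (φ : lang.BoundedFormula β (n + 1)) :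
    lang.BoundedFormula β n :=
  (memLast t ⊓ φ).ex

/-- The `Δ₀`-formulas: built from atomic formulas by propositional connectives and bounded
quantifiers (negation is `φ ⟹ ⊥`, and conjunction and disjunction are expressed by `⟹` and `⊥`). -/
inductive IsDelta0 {β : Type} : ∀ {n : ℕ}, lang.BoundedFormula β n → Prop
  | atomic {n : ℕ} {φ : lang.BoundedFormula β n} (h : φ.IsAtomic) : IsDelta0 φ
  | falsum {n : ℕ} : IsDelta0 (⊥ : lang.BoundedFormula β n)
  | imp {n : ℕ} {φ ψ : lang.BoundedFormula β n} (h : IsDelta0 φ) (k : IsDelta0 ψ) :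
      IsDelta0 (φ.imp ψ)
  | ballMem {n : ℕ} (t : lang.Term (β ⊕ Fin n)) {φ : lang.BoundedFormula β (n + 1)}
      (h : IsDelta0 φ) : IsDelta0 (ballMem t φ)
  | bexMem {n : ℕ} (t : lang.Term (β ⊕ Fin n)) {φ : lang.BoundedFormula β (n + 1)}
      (h : IsDelta0 φ) : IsDelta0 (bexMem t φ)

/-- The `Σ`-formulas: built from `Δ₀`-formulas by conjunction, disjunction, bounded quantifiers and
unbounded existential quantifiers. -/
inductive IsSigma {β : Type} : ∀ {n : ℕ}, lang.BoundedFormula β n → Prop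
  | delta0 {n : ℕ} {φ : lang.BoundedFormula β n} (h : IsDelta0 φ) : IsSigma φ
  | inf {n : ℕ} {φ ψ : lang.BoundedFormula β n} (h : IsSigma φ) (k : IsSigma ψ) : IsSigma (φ ⊓ ψ)
  | sup {n : ℕ} {φ ψ : lang.BoundedFormula β n} (h : IsSigma φ) (k : IsSigma ψ) : IsSigma (φ ⊔ ψ)
  | ballMem {n : ℕ} (t : lang.Term (β ⊕ Fin n)) {φ : lang.BoundedFormula β (n + 1)}
      (h : IsSigma φ) : IsSigma (ballMem t φ)
  | bexMem {n : ℕ} (t : lang.Term (β ⊕ Fin n)) {φ : lang.BoundedFormula β (n + 1)}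
      (h : IsSigma φ) : IsSigma (bexMem t φ)
  | ex {n : ℕ} {φ : lang.BoundedFormula β (n + 1)} (h : IsSigma φ) : IsSigma φ.ex

/-- `S ⊆ ℝ` is `Σ`-definable in `HF(ℝ, 0, 1, +, ×)` with parameters from `A ⊆ ℝ`. The variables of
the formula are one variable for each parameter `a ∈ A`, taking the value `a`, and one more variable
for the argument. -/
def SigmaDefinable (A S : Set ℝ) : Prop :=
  ∃ φ : lang.Formula (A ⊕ Unit), IsSigma φ ∧
    ∀ x : ℝ, x ∈ S ↔ φ.Realize (Sum.elim (fun a : A => atom (a : ℝ)) fun _ => atom x)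

/-- Membership in `S ⊆ ℝ` is algorithmically decidable, for algorithms over the reals that may use
the constants in `A`: both `S` and its complement are `Σ`-definable in `HF(ℝ, 0, 1, +, ×)` with
parameters from `A`. -/
def Decides (A S : Set ℝ) : Prop := SigmaDefinable A S ∧ SigmaDefinable A Sᶜ

end HF

/-- Generation from `P` by `G`: all elements of `P` are generated, and `g(x₁, …, xₖ)` is generated
whenever `g ∈ G`, all `xᵢ` are generated and all `xᵢ` are smaller than `g(x₁, …, xₖ)`. -/
inductive Generated (G : Set (Σ k : ℕ, (Fin k → ℝ) → ℝ)) (P : Set ℝ) : ℝ → Prop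
  | base {x : ℝ} (h : x ∈ P) : Generated G P x
  | app {k : ℕ} {g : (Fin k → ℝ) → ℝ} (hg : (⟨k, g⟩ : Σ k : ℕ, (Fin k → ℝ) → ℝ) ∈ G)
      {x : Fin k → ℝ} (hx : ∀ i, Generated G P (x i)) (hlt : ∀ i, x i < g x) : Generated G P (g x)

/-- The inclusion-least set `F(G, P)` that contains `P` and is closed under those applications of
functions from `G` whose value is larger than all arguments. -/
def genSet (G : Set (Σ k : ℕ, (Fin k → ℝ) → ℝ)) (P : Set ℝ) : Set ℝ := {x | Generated G P x}

/-! Both membership and non-membership in the closure C of the generated set F have finite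
certificates, and a `Σ`-formula can ask for such a certificate as a hereditarily finite set.

F is well-ordered because monotone images of finite powers of well-ordered sets are partially
well-ordered; C inherits this (`isWF_genSet`, `isWF_closure`).

Membership: a point x of C outside P is a limit of values g(y_k), where the y_k may be taken
coordinatewise nondecreasing. Let I be the set of coordinates whose limit is x itself. Then x is a
fixed point, of slope less than 1, of the map that puts t in the places of I and fixed smaller
elements of C elsewhere; conversely, such fixed points lie in C. By well-foundedness, x is in C iff
it has a finite derivation from smaller elements (`mem_closure_iff_exists_finite`).

Non-membership: the certificate is some w > x with finitely many closed intervals that miss x, cover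
P below w and absorb the values of g below w. Soundness is an induction on generation. For
existence, C below w is cut at a finite set M of left-isolated points. The minimal argument tuples
at which g reaches a left-isolated m are finitely many and have left-isolated coordinates, so
well-foundedness yields an M containing all thresholds needed (`exists_finite_forall_covers`). The
intervals run from each cut to the last point of C before the next one. -/

namespace HF

/-! ### Finite sets in `HF α` -/

theorem atom_injective {α : Type} : Function.Injective (atom : α → HF α) := fun _ _ h =>
  Quotient.exact (s := PreHF.setoid α) h

theorem finite_setOf_mem {α : Type} (D : HF α) : {z | Mem z D}.Finite := by
  induction D using Quotient.inductionOn with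
  | h d =>
    cases d with
    | atom a =>
      refine Set.finite_empty.subset fun z hz => ?_
      induction z using Quotient.inductionOn
      exact hz.elim
    | node k f =>
      refine (Set.finite_range fun i => (Quotient.mk (PreHF.setoid α) (f i))).subset fun z hz => ?_
      induction z using Quotient.inductionOn
      obtain ⟨i, hi⟩ := hz
      exact ⟨i, (Quotient.sound hi).symm⟩

theorem exists_mem_iff {α : Type} {S : Set (HF α)} (hS : S.Finite) :
    ∃ D : HF α, ∀ z, Mem z D ↔ z ∈ S := by
  obtain ⟨k, f, rfl⟩ : ∃ (k : ℕ) (f : Fin k → HF α), S = Set.range f := by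
    have := hS.fintype
    let e := Fintype.equivFin S
    refine ⟨_, fun i => (e.symm i : HF α), ?_⟩
    rw [Set.range_comp' Subtype.val, e.symm.range_eq_univ]
    simp
  refine ⟨Quotient.mk (PreHF.setoid α) (.node k fun i => (f i).out), fun z => ?_⟩
  induction z using Quotient.inductionOn with
  | h z =>
    constructor
    · rintro ⟨i, hi⟩
      exact ⟨i, ((Quotient.sound hi).trans (Quotient.out_eq _)).symm⟩
    · rintro ⟨i, hi⟩
      exact ⟨i, Quotient.exact (s := PreHF.setoid α) (hi.symm.trans (Quotient.out_eq _).symm)⟩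

open Classical in
/-- The real number denoted by an urelement; sets have the value `0`. -/
noncomputable def val (z : HF ℝ) : ℝ := if h : ∃ x : ℝ, z = atom x then h.choose else 0

@[simp] theorem val_atom (x : ℝ) : val (atom x) = x := by
  have h : ∃ y : ℝ, (atom x : HF ℝ) = atom y := ⟨x, rfl⟩
  rw [val, dif_pos h]
  exact (atom_injective h.choose_spec).symm

theorem atom_eq_val {z : HF ℝ} (h : ∃ x : ℝ, z = atom x) : atom (val z) = z := by
  obtain ⟨x, rfl⟩ := h
  rw [val_atom]

theorem val_of_not {z : HF ℝ} (h : ¬ ∃ x : ℝ, z = atom x) : val z = 0 := dif_neg h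

/-! ### Definability of relations and functions in a context of variables -/

open FirstOrder Language

/-- Values of the argument and of `n` bound variables. -/
abbrev Ctx (n : ℕ) : Type := HF ℝ × (Fin n → HF ℝ)

/-- The context without its last variable. -/
def Ctx.init {n : ℕ} (c : Ctx (n + 1)) : Ctx n := (c.1, fun i => c.2 i.castSucc)

/-- The last variable of a context. -/
def Ctx.last {n : ℕ} (c : Ctx (n + 1)) : HF ℝ := c.2 (Fin.last n)

/-- The context enlarged by one variable. -/
def Ctx.snoc {n : ℕ} (c : Ctx n) (z : HF ℝ) : Ctx (n + 1) :=
  (c.1, Fin.snoc (α := fun _ => HF ℝ) c.2 z)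

@[simp] theorem Ctx.init_snoc {n : ℕ} (c : Ctx n) (z : HF ℝ) : (c.snoc z).init = c := by
  simp [Ctx.init, Ctx.snoc]

@[simp] theorem Ctx.last_snoc {n : ℕ} (c : Ctx n) (z : HF ℝ) : (c.snoc z).last = z := by
  simp [Ctx.last, Ctx.snoc]

/-- The assignment of the parameters and of the argument. -/
def assignment (A : Set ℝ) (x : HF ℝ) : A ⊕ Unit → HF ℝ :=
  Sum.elim (fun a : A => atom (a : ℝ)) fun _ => x

variable {A : Set ℝ} {n : ℕ}

/-- `f` is the value of a term. -/
def IsVar (A : Set ℝ) (f : Ctx n → HF ℝ) : Prop :=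
  ∃ t : lang.Term ((A ⊕ Unit) ⊕ Fin n), ∀ c : Ctx n,
    t.realize (Sum.elim (assignment A c.1) c.2) = f c

/-- `R` is defined by a `Σ`-formula. -/
def Sig (A : Set ℝ) (R : Ctx n → Prop) : Prop :=
  ∃ φ : lang.BoundedFormula (A ⊕ Unit) n, IsSigma φ ∧
    ∀ c : Ctx n, φ.Realize (assignment A c.1) c.2 ↔ R c

/-- Substitutions of terms for variables. -/
def IsProj (A : Set ℝ) {m n : ℕ} (e : Ctx m → Ctx n) : Prop :=
  ∀ ⦃f : Ctx n → HF ℝ⦄, IsVar A f → IsVar A fun c => f (e c)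

theorem isVar_arg : IsVar A fun c : Ctx n => c.1 :=
  ⟨.var (.inl (.inr ())), fun _ => rfl⟩

theorem isVar_param {r : ℝ} (h : r ∈ A) : IsVar A fun _ : Ctx n => atom r :=
  ⟨.var (.inl (.inl ⟨r, h⟩)), fun _ => rfl⟩

theorem isVar_last : IsVar A fun c : Ctx (n + 1) => c.last :=
  ⟨.var (.inr (Fin.last n)), fun _ => rfl⟩

theorem isProj_init : IsProj A fun c : Ctx (n + 1) => c.init := by
  rintro f ⟨t, ht⟩
  refine ⟨t.relabel (Sum.map id Fin.castSucc), fun c => ?_⟩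
  rw [Term.realize_relabel, Sum.elim_comp_map]
  exact ht c.init

theorem isProj_id : IsProj A fun c : Ctx n => c := fun _ h => h

theorem IsProj.comp {l m : ℕ} {e : Ctx m → Ctx n} {e' : Ctx l → Ctx m} (h : IsProj A e)
    (h' : IsProj A e') : IsProj A fun c => e (e' c) := fun _ hf => h' (h hf)

theorem Sig.congr {R S : Ctx n → Prop} (h : Sig A R) (k : ∀ c, S c ↔ R c) : Sig A S := by
  obtain ⟨φ, hφ, hR⟩ := h
  exact ⟨φ, hφ, fun c => (hR c).trans (k c).symm⟩

theorem sig_false : Sig A fun _ : Ctx n => False :=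
  ⟨⊥, .delta0 .falsum, fun _ => Iff.rfl⟩

theorem sig_true : Sig A fun _ : Ctx n => True :=
  ⟨.imp ⊥ ⊥, .delta0 (.imp .falsum .falsum), fun _ => by simp⟩

theorem Sig.and {R S : Ctx n → Prop} (h : Sig A R) (k : Sig A S) : Sig A fun c => R c ∧ S c := by
  obtain ⟨φ, hφ, hR⟩ := h
  obtain ⟨ψ, hψ, hS⟩ := k
  exact ⟨φ ⊓ ψ, .inf hφ hψ, fun c => by rw [BoundedFormula.realize_inf, hR, hS]⟩

theorem Sig.or {R S : Ctx n → Prop} (h : Sig A R) (k : Sig A S) : Sig A fun c => R c ∨ S c := by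
  obtain ⟨φ, hφ, hR⟩ := h
  obtain ⟨ψ, hψ, hS⟩ := k
  exact ⟨φ ⊔ ψ, .sup hφ hψ, fun c => by rw [BoundedFormula.realize_sup, hR, hS]⟩

theorem Sig.exists_finite {ι : Type} {s : Set ι} (hs : s.Finite) {R : ι → Ctx n → Prop}
    (h : ∀ i ∈ s, Sig A (R i)) : Sig A fun c => ∃ i ∈ s, R i c := by
  induction s, hs using Set.Finite.induction_on with
  | empty => exact sig_false.congr fun c => by simp
  | insert _ _ ih =>
    exact ((h _ (.inl rfl)).or (ih fun i hi => h i (.inr hi))).congr fun c => by simp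

theorem Sig.forall_finite {ι : Type} {s : Set ι} (hs : s.Finite) {R : ι → Ctx n → Prop}
    (h : ∀ i ∈ s, Sig A (R i)) : Sig A fun c => ∀ i ∈ s, R i c := by
  induction s, hs using Set.Finite.induction_on with
  | empty => exact sig_true.congr fun c => by simp
  | insert _ _ ih =>
    exact ((h _ (.inl rfl)).and (ih fun i hi => h i (.inr hi))).congr fun c => by simp

theorem Sig.exists_fin {k : ℕ} {R : Fin k → Ctx n → Prop} (h : ∀ i, Sig A (R i)) :
    Sig A fun c => ∃ i, R i c :=
  (Sig.exists_finite Set.finite_univ fun i _ => h i).congr fun c => by simp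

theorem Sig.forall_fin {k : ℕ} {R : Fin k → Ctx n → Prop} (h : ∀ i, Sig A (R i)) :
    Sig A fun c => ∀ i, R i c :=
  (Sig.forall_finite Set.finite_univ fun i _ => h i).congr fun c => by simp

theorem Sig.ex {R : Ctx n → HF ℝ → Prop}
    (h : Sig A fun c : Ctx (n + 1) => R c.init c.last) : Sig A fun c => ∃ z, R c z := by
  obtain ⟨φ, hφ, hR⟩ := h
  refine ⟨φ.ex, .ex hφ, fun c => ?_⟩
  rw [BoundedFormula.realize_ex]
  refine exists_congr fun z => (hR (c.snoc z)).trans ?_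
  simp only [Ctx.init_snoc, Ctx.last_snoc]

theorem realize_memLast (t : lang.Term ((A ⊕ Unit) ⊕ Fin n)) (c : Ctx n) (z : HF ℝ) :
    (memLast t).Realize (assignment A c.1) (c.snoc z).2 ↔
      Mem z (t.realize (Sum.elim (assignment A c.1) c.2)) := by
  have h : (Sum.elim (assignment A c.1) (c.snoc z).2) ∘ Sum.map id Fin.castSucc =
      Sum.elim (assignment A c.1) c.2 := by
    rw [Sum.elim_comp_map]
    congr 1
    funext i
    simp [Ctx.snoc]
  refine BoundedFormula.realize_rel₂.trans ?_
  rw [Term.realize_relabel, h]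
  change Mem ((c.snoc z).last) _ ↔ _
  rw [Ctx.last_snoc]
  rfl

theorem Sig.ball {B : Ctx n → HF ℝ} (hB : IsVar A B) {R : Ctx n → HF ℝ → Prop}
    (h : Sig A fun c : Ctx (n + 1) => R c.init c.last) :
    Sig A fun c => ∀ z, Mem z (B c) → R c z := by
  obtain ⟨φ, hφ, hR⟩ := h
  obtain ⟨t, ht⟩ := hB
  refine ⟨HF.ballMem t φ, .ballMem t hφ, fun c => ?_⟩
  rw [HF.ballMem, BoundedFormula.realize_all]
  refine forall_congr' fun z => ?_
  rw [BoundedFormula.realize_imp]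
  refine imp_congr ?_ ((hR (c.snoc z)).trans ?_)
  · rw [← ht]
    exact realize_memLast t c z
  · simp only [Ctx.init_snoc, Ctx.last_snoc]

/-- The matrix is required in every admissible larger context, so that the induction on `k` can add
one variable at a time. -/
theorem Sig.exists_tuple {k : ℕ} {R : Ctx n → (Fin k → HF ℝ) → Prop}
    (h : ∀ (m : ℕ) (e : Ctx m → Ctx n) (y : Fin k → Ctx m → HF ℝ), IsProj A e →
      (∀ i, IsVar A (y i)) → Sig A fun c => R (e c) fun i => y i c) :
    Sig A fun c => ∃ y, R c y := by
  induction k generalizing n with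
  | zero =>
    refine (h n _ (fun i => i.elim0) isProj_id fun i => i.elim0).congr fun c => ?_
    rw [Fin.exists_fin_zero_pi]
    exact iff_of_eq (congrArg _ (Subsingleton.elim _ _))
  | succ k ih =>
    have : Sig A fun c => ∃ z, ∃ y : Fin k → HF ℝ, R c (Fin.cons z y) := by
      refine Sig.ex (ih fun m e y he hy => ?_)
      refine (h m _ (Fin.cons (fun c => (e c).last) y) (isProj_init.comp he) ?_).congr fun c => ?_
      · exact Fin.cases (he isVar_last) hy
      · refine iff_of_eq (congrArg _ (funext fun i => ?_))
        cases i using Fin.cases <;> rfl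
    exact this.congr fun c => Fin.exists_fin_succ_pi

theorem Sig.ball_tuple {k : ℕ} {B : Fin k → Ctx n → HF ℝ} (hB : ∀ i, IsVar A (B i))
    {R : Ctx n → (Fin k → HF ℝ) → Prop}
    (h : ∀ (m : ℕ) (e : Ctx m → Ctx n) (y : Fin k → Ctx m → HF ℝ), IsProj A e →
      (∀ i, IsVar A (y i)) → Sig A fun c => R (e c) fun i => y i c) :
    Sig A fun c => ∀ y, (∀ i, Mem (y i) (B i c)) → R c y := by
  induction k generalizing n with
  | zero =>
    refine (h n _ (fun i => i.elim0) isProj_id fun i => i.elim0).congr fun c => ?_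
    rw [Fin.forall_fin_zero_pi]
    simp only [IsEmpty.forall_iff, true_imp_iff]
    exact iff_of_eq (congrArg _ (Subsingleton.elim _ _))
  | succ k ih =>
    have : Sig A fun c => ∀ z, Mem z (B 0 c) → ∀ y : Fin k → HF ℝ,
        (∀ i, Mem (y i) (B i.succ c)) → R c (Fin.cons z y) := by
      refine Sig.ball (hB 0) (ih (fun i => isProj_init (hB i.succ)) fun m e y he hy => ?_)
      refine (h m _ (Fin.cons (fun c => (e c).last) y) (isProj_init.comp he) ?_).congr fun c => ?_
      · exact Fin.cases (he isVar_last) hy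
      · refine iff_of_eq (congrArg _ (funext fun i => ?_))
        cases i using Fin.cases <;> rfl
    refine this.congr fun c => ?_
    rw [Fin.forall_fin_succ_pi]
    simp only [Fin.forall_fin_succ, Fin.cons_zero, Fin.cons_succ]
    exact ⟨fun H z hz y hy => H z y ⟨hz, hy⟩, fun H z y hy => H z hy.1 y hy.2⟩

/-! ### Atomic relations -/

theorem sig_rel {k : ℕ} (r : Rel k) {f : Fin k → Ctx n → HF ℝ} (hf : ∀ i, IsVar A (f i)) :
    Sig A fun c => Structure.RelMap (L := lang) (M := HF ℝ) r fun i => f i c := by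
  choose t ht using hf
  refine ⟨Relations.boundedFormula (L := lang) r t, .delta0 (.atomic (.rel _ _)), fun c => ?_⟩
  refine BoundedFormula.realize_rel.trans ?_
  simp only [ht]

variable {f g h : Ctx n → HF ℝ}

theorem sig_eq (hf : IsVar A f) (hg : IsVar A g) : Sig A fun c => f c = g c := by
  obtain ⟨t, ht⟩ := hf
  obtain ⟨s, hs⟩ := hg
  refine ⟨t.bdEqual s, .delta0 (.atomic (.equal _ _)), fun c => ?_⟩
  rw [BoundedFormula.realize_bdEqual, ht, hs]

theorem sig_mem (hf : IsVar A f) (hg : IsVar A g) : Sig A fun c => Mem (f c) (g c) :=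
  sig_rel .mem (f := ![f, g]) (Fin.forall_fin_two.2 ⟨hf, hg⟩)

theorem sig_isReal (hf : IsVar A f) : Sig A fun c => ∃ x : ℝ, f c = atom x :=
  sig_rel .isReal (f := ![f]) (by simpa using hf)

theorem sig_not_isReal (hf : IsVar A f) : Sig A fun c => ¬ ∃ x : ℝ, f c = atom x := by
  obtain ⟨t, ht⟩ := hf
  refine ⟨(Relations.boundedFormula (L := lang) Rel.isReal ![t]).imp ⊥,
    .delta0 (.imp (.atomic (.rel _ _)) .falsum), fun c => ?_⟩
  refine (BoundedFormula.realize_imp.trans (imp_congr_left BoundedFormula.realize_rel)).trans ?_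
  simp only [← ht]
  rfl

theorem sig_eq_zero (hf : IsVar A f) : Sig A fun c => f c = atom 0 :=
  sig_rel .isZero (f := ![f]) (by simpa using hf)

theorem sig_eq_one (hf : IsVar A f) : Sig A fun c => f c = atom 1 :=
  sig_rel .isOne (f := ![f]) (by simpa using hf)

theorem sig_add (hf : IsVar A f) (hg : IsVar A g) (hh : IsVar A h) :
    Sig A fun c => ∃ x y : ℝ, f c = atom x ∧ g c = atom y ∧ h c = atom (x + y) :=
  sig_rel .add (f := ![f, g, h]) (by simp [Fin.forall_fin_succ, hf, hg, hh])

theorem sig_mul (hf : IsVar A f) (hg : IsVar A g) (hh : IsVar A h) :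
    Sig A fun c => ∃ x y : ℝ, f c = atom x ∧ g c = atom y ∧ h c = atom (x * y) :=
  sig_rel .mul (f := ![f, g, h]) (by simp [Fin.forall_fin_succ, hf, hg, hh])

/-! ### Real-valued functions with `Σ`-definable graph -/

/-- The graph of `u` is `Σ`-definable in every larger context. -/
def SigFun (A : Set ℝ) (u : Ctx n → ℝ) : Prop :=
  ∀ ⦃m : ℕ⦄ ⦃e : Ctx m → Ctx n⦄ ⦃z : Ctx m → HF ℝ⦄, IsProj A e → IsVar A z →
    Sig A fun c => z c = atom (u (e c))

variable {u v : Ctx n → ℝ}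

theorem SigFun.proj {m : ℕ} {e : Ctx m → Ctx n} (hu : SigFun A u) (he : IsProj A e) :
    SigFun A fun c => u (e c) := fun _ _ _ he' hz => hu (he.comp he') hz

theorem sigFun_val (hf : IsVar A f) : SigFun A fun c => val (f c) := by
  intro m e z he hz
  refine (((sig_isReal (he hf)).and (sig_eq hz (he hf))).or
    ((sig_not_isReal (he hf)).and (sig_eq_zero hz))).congr fun c => ?_
  by_cases h : ∃ x : ℝ, f (e c) = atom x
  · simp only [atom_eq_val h, h, not_true, true_and, false_and, or_false]
  · simp only [val_of_not h, h, not_false_eq_true, true_and, false_and, false_or]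

theorem sigFun_param {r : ℝ} (hr : r ∈ A) : SigFun A fun _ : Ctx n => r :=
  fun _ _ _ _ hz => sig_eq hz (isVar_param hr)

theorem sigFun_zero : SigFun A fun _ : Ctx n => 0 := fun _ _ _ _ hz => sig_eq_zero hz

theorem sigFun_one : SigFun A fun _ : Ctx n => 1 := fun _ _ _ _ hz => sig_eq_one hz

theorem SigFun.add (hu : SigFun A u) (hv : SigFun A v) : SigFun A fun c => u c + v c := by
  intro m e z he hz
  have : Sig A fun c => ∃ p q, (p = atom (u (e c)) ∧ q = atom (v (e c))) ∧
      ∃ x y : ℝ, p = atom x ∧ q = atom y ∧ z c = atom (x + y) :=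
    Sig.ex <| Sig.ex <| ((hu (he.comp (isProj_init.comp isProj_init))
      (isProj_init isVar_last)).and (hv (he.comp (isProj_init.comp isProj_init)) isVar_last)).and
      (sig_add (isProj_init isVar_last) isVar_last (isProj_init (isProj_init hz)))
  refine this.congr fun c => ⟨fun h => ⟨_, _, ⟨rfl, rfl⟩, _, _, rfl, rfl, h⟩, ?_⟩
  rintro ⟨_, _, ⟨rfl, rfl⟩, _, _, hx, hy, h⟩
  rwa [← atom_injective hx, ← atom_injective hy] at h

theorem SigFun.mul (hu : SigFun A u) (hv : SigFun A v) : SigFun A fun c => u c * v c := by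
  intro m e z he hz
  have : Sig A fun c => ∃ p q, (p = atom (u (e c)) ∧ q = atom (v (e c))) ∧
      ∃ x y : ℝ, p = atom x ∧ q = atom y ∧ z c = atom (x * y) :=
    Sig.ex <| Sig.ex <| ((hu (he.comp (isProj_init.comp isProj_init))
      (isProj_init isVar_last)).and (hv (he.comp (isProj_init.comp isProj_init)) isVar_last)).and
      (sig_mul (isProj_init isVar_last) isVar_last (isProj_init (isProj_init hz)))
  refine this.congr fun c => ⟨fun h => ⟨_, _, ⟨rfl, rfl⟩, _, _, rfl, rfl, h⟩, ?_⟩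
  rintro ⟨_, _, ⟨rfl, rfl⟩, _, _, hx, hy, h⟩
  rwa [← atom_injective hx, ← atom_injective hy] at h

theorem SigFun.sum {ι : Type} {s : Finset ι} {w : ι → Ctx n → ℝ} (h : ∀ i, SigFun A (w i)) :
    SigFun A fun c => ∑ i ∈ s, w i c := by
  classical
  induction s using Finset.induction_on with
  | empty => simpa using sigFun_zero
  | insert i s hi ih => simpa only [Finset.sum_insert hi] using (h i).add ih

theorem SigFun.eq (hu : SigFun A u) (hv : SigFun A v) : Sig A fun c => u c = v c := by
  have : Sig A fun c => ∃ p, p = atom (u c) ∧ p = atom (v c) :=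
    Sig.ex <| (hu isProj_init isVar_last).and (hv isProj_init isVar_last)
  exact this.congr fun c => by simp [atom_injective.eq_iff]

/-- Order is not primitive: nonnegative differences are squares, and below strictness is the
existence of an inverse of the difference. Both are existential. -/
theorem SigFun.le (hu : SigFun A u) (hv : SigFun A v) : Sig A fun c => u c ≤ v c := by
  have : Sig A fun c => ∃ r, v c = u c + val r * val r :=
    Sig.ex <| (hv.proj isProj_init).eq <| (hu.proj isProj_init).add <|
      (sigFun_val isVar_last).mul (sigFun_val isVar_last)
  refine this.congr fun c => ⟨fun h => ⟨atom √(v c - u c), ?_⟩, ?_⟩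
  · rw [val_atom, Real.mul_self_sqrt (sub_nonneg.2 h)]
    ring
  · rintro ⟨r, h⟩
    nlinarith [mul_self_nonneg (val r)]

theorem SigFun.lt (hu : SigFun A u) (hv : SigFun A v) : Sig A fun c => u c < v c := by
  have : Sig A fun c => u c ≤ v c ∧ ∃ r, v c * val r = u c * val r + 1 :=
    (hu.le hv).and <| Sig.ex <| ((hv.proj isProj_init).mul (sigFun_val isVar_last)).eq <|
      ((hu.proj isProj_init).mul (sigFun_val isVar_last)).add sigFun_one
  refine this.congr fun c => ⟨fun h => ⟨h.le, atom (v c - u c)⁻¹, ?_⟩, ?_⟩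
  · have := mul_inv_cancel₀ (sub_pos.2 h).ne'
    rw [val_atom]
    linarith
  · rintro ⟨h, r, hr⟩
    refine h.lt_of_ne fun h' => ?_
    rw [h'] at hr
    linarith

theorem Sig.sigmaDefinable {R : Ctx 0 → Prop} {S : Set ℝ} (h : Sig A R)
    (hS : ∀ x, x ∈ S ↔ R (atom x, default)) : SigmaDefinable A S := by
  obtain ⟨φ, hφ, hR⟩ := h
  exact ⟨φ, hφ, fun x => (hS x).trans (hR (atom x, default)).symm⟩

end HF

namespace HF

open Filter Topology

/-! ### Well-ordering of the generated set and of its closure -/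

theorem isWF_of_forall_Iic {W : Set ℝ} (h : ∀ x ∈ W, (W ∩ Set.Iic x).IsWF) : W.IsWF := by
  rw [Set.isWF_iff_no_descending_seq]
  intro f hf hW
  refine Set.isWF_iff_no_descending_seq.1 (h _ (hW 0)) (fun k => f k) hf fun k => ?_
  exact ⟨hW k, hf.antitone (Nat.zero_le k)⟩

variable {n : ℕ} {g : (Fin n → ℝ) → ℝ} {P : Set ℝ}

/-- `W` is the well-ordered initial part of F. A least element of F outside `W` that lies in P or is
a value of g on `W` would itself belong to `W`; so there is none, and induction on generation gives
F ⊆ `W`. -/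
theorem isWF_genSet (hmono : Monotone g) (hP : P.Finite) :
    (genSet {⟨n, g⟩} P).IsWF := by
  set F := genSet {⟨n, g⟩} P
  set W : Set ℝ := {x | x ∈ F ∧ (F ∩ Set.Iic x).IsWF}
  have hWF : W.IsWF := isWF_of_forall_Iic fun x hx =>
    hx.2.mono fun y hy => ⟨hy.1.1, hy.2⟩
  set Z : Set ℝ := (P ∪ g '' Set.univ.pi fun _ => W) ∩ (F \ W)
  have hZWF : Z.IsWF := by
    refine Set.IsPWO.isWF (Set.IsPWO.mono (hP.isPWO.union ?_) Set.inter_subset_left)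
    exact (Set.IsPWO.pi fun _ => Set.isPWO_iff_isWF.2 hWF).image_of_monotone hmono
  -- The bound `z` is the minimum of `Z` if there is one, and `⊤` once `Z` is known to be empty.
  have key : ∀ z : WithTop ℝ, (∀ x ∈ Z, z ≤ x) → ∀ x, Generated {⟨n, g⟩} P x → (x : WithTop ℝ) < z →
      x ∈ W := by
    intro z hz x hx
    induction hx with
    | @base x h =>
      intro hxz
      by_contra hn
      exact (hz x ⟨.inl h, .base h, hn⟩).not_gt hxz
    | @app k g' hg y hy hlt ih =>
      intro hxz
      obtain ⟨rfl, h⟩ : k = n ∧ g' ≍ g := by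
        simpa only [Set.mem_singleton_iff, Sigma.mk.injEq] using hg
      obtain rfl := eq_of_heq h
      by_contra hn
      refine (hz _ ⟨.inr ⟨y, fun i _ => ih i ?_, rfl⟩, .app hg hy hlt, hn⟩).not_gt hxz
      exact lt_trans (WithTop.coe_lt_coe.2 (hlt i)) hxz
  have hZe : ¬ Z.Nonempty := by
    intro hne
    have hm := hZWF.min_mem hne
    refine hm.2.2 ⟨hm.2.1, (hWF.insert (hZWF.min hne)).mono ?_⟩
    rintro y ⟨hy, hle⟩
    rcases eq_or_lt_of_le (show y ≤ _ from hle) with rfl | hlt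
    · exact .inl rfl
    · exact .inr (key (hZWF.min hne : ℝ) (fun x hx => WithTop.coe_le_coe.2 (hZWF.min_le hne hx)) y
        hy (WithTop.coe_lt_coe.2 hlt))
  refine hWF.mono fun x hx => key ⊤ (fun x hx => (hZe ⟨x, hx⟩).elim) x hx (WithTop.coe_lt_top x)

/-- Around every odd term of a descending sequence in the closure, the interval between its
neighbours contains a point of `F`; these points descend too. -/
theorem isWF_closure {F : Set ℝ} (hF : F.IsWF) : (closure F).IsWF := by
  rw [Set.isWF_iff_no_descending_seq]
  intro s hs hC
  have (k : ℕ) : ∃ f ∈ F, s (2 * k + 2) < f ∧ f < s (2 * k) := by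
    obtain ⟨f, hf, hfF⟩ := mem_closure_iff.1 (hC (2 * k + 1)) _
      (isOpen_Ioo (a := s (2 * k + 2)) (b := s (2 * k))) ⟨hs (by lia), hs (by lia)⟩
    exact ⟨f, hfF, hf⟩
  choose f hfF h₁ h₂ using this
  refine Set.isWF_iff_no_descending_seq.1 hF f (strictAnti_nat_of_succ_lt fun k => ?_) hfF
  exact (h₂ (k + 1)).trans (h₁ k)

/-! ### Closure under applications -/

theorem apply_mem_closure (hcont : Continuous g) {y : Fin n → ℝ}
    (hy : ∀ i, y i ∈ closure (genSet {⟨n, g⟩} P)) (hlt : ∀ i, y i < g y) :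
    g y ∈ closure (genSet {⟨n, g⟩} P) := by
  have hO : IsOpen {y : Fin n → ℝ | ∀ i, y i < g y} := by
    simp only [Set.ofPred_forall]
    exact isOpen_iInter_of_finite fun i => isOpen_lt (continuous_apply i) hcont
  have hy' : y ∈ closure (Set.univ.pi fun _ : Fin n => genSet {⟨n, g⟩} P) := by
    rw [closure_pi_set]
    exact fun i _ => hy i
  refine map_mem_closure hcont (hO.inter_closure ⟨hlt, hy'⟩) ?_
  rintro z ⟨hz, hzF⟩
  exact Generated.app (Set.mem_singleton _) (fun i => hzF i trivial) hz

/-- If g y does not exceed all arguments it need not lie in the closure, but then the largest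
argument dominates it. -/
theorem exists_mem_closure_ge (hcont : Continuous g) {y : Fin n → ℝ} {m : ℝ}
    (hy : ∀ i, y i ∈ closure (genSet {⟨n, g⟩} P)) (hm : ∀ i, y i < m) (hg : g y < m) :
    ∃ c ∈ closure (genSet {⟨n, g⟩} P), c < m ∧ g y ≤ c ∧ (∀ i, y i ≤ c) ∧
      (c = g y ∨ ∃ i, c = y i) := by
  by_cases h : ∀ i, y i < g y
  · exact ⟨g y, apply_mem_closure hcont hy h, hg, le_rfl, fun i => (h i).le, .inl rfl⟩
  · push Not at h
    obtain ⟨i, hi⟩ := h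
    have : Nonempty (Fin n) := ⟨i⟩
    obtain ⟨j, hj⟩ := Finite.exists_max y
    exact ⟨y j, hy j, hm j, hi.trans (hj i), hj, .inr ⟨j, rfl⟩⟩

/-! ### A generation of the closure by smaller elements -/

variable {a : Fin n → ℝ} {b : ℝ}

theorem coeff_nonneg (hlin : ∀ x, g x = ∑ i, a i * x i + b) (hmono : Monotone g) (i : Fin n) :
    0 ≤ a i := by
  have h := hmono (show (0 : Fin n → ℝ) ≤ Pi.single i 1 from Pi.single_nonneg.2 zero_le_one)
  rw [hlin, hlin] at h
  simpa [Pi.single_apply] using h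

theorem continuous_of_affine (hlin : ∀ x, g x = ∑ i, a i * x i + b) : Continuous g := by
  rw [funext hlin]
  fun_prop

theorem apply_ite (hlin : ∀ x, g x = ∑ i, a i * x i + b) (I : Finset (Fin n)) (y : Fin n → ℝ)
    (x t : ℝ) : g (fun i => if i ∈ I then t else y i) =
      g (fun i => if i ∈ I then x else y i) + (∑ i ∈ I, a i) * (t - x) := by
  have : (∑ i ∈ I, a i) * (t - x) = ∑ i, if i ∈ I then a i * (t - x) else 0 := by
    rw [Finset.sum_mul, ← Finset.sum_filter, Finset.filter_mem_eq_inter, Finset.univ_inter]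
  rw [hlin, hlin, this, add_right_comm, ← Finset.sum_add_distrib]
  congr 1
  refine Finset.sum_congr rfl fun i _ => ?_
  split_ifs <;> ring

/-- If the largest point s ≤ x of the closure were below x, slope less than 1 would make the value
at s lie strictly above s and at most x, a contradiction. -/
theorem fixedPoint_mem_closure (hlin : ∀ x, g x = ∑ i, a i * x i + b) (hmono : Monotone g)
    {I : Finset (Fin n)} (hI : ∑ i ∈ I, a i < 1) {y : Fin n → ℝ} {x : ℝ}
    (hy : ∀ i, y i ∈ closure (genSet {⟨n, g⟩} P)) (hlt : ∀ i, y i < x)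
    (hx : x = g fun i => if i ∈ I then x else y i) : x ∈ closure (genSet {⟨n, g⟩} P) := by
  have hcont := continuous_of_affine hlin
  set C := closure (genSet {⟨n, g⟩} P)
  rcases I.eq_empty_or_nonempty with rfl | ⟨i₀, -⟩
  · simp only [Finset.notMem_empty, if_false] at hx
    rw [hx]
    exact apply_mem_closure hcont hy fun i => hx ▸ hlt i
  · have hne : (C ∩ Set.Iic x).Nonempty := ⟨y i₀, hy i₀, (hlt i₀).le⟩
    have hbdd : BddAbove (C ∩ Set.Iic x) := ⟨x, fun _ h => h.2⟩
    have hs := (isClosed_closure.inter isClosed_Iic).csSup_mem hne hbdd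
    set s := sSup (C ∩ Set.Iic x)
    rcases eq_or_lt_of_le (show s ≤ x from hs.2) with h | h
    · exact h ▸ hs.1
    have hys (i : Fin n) : y i ≤ s := le_csSup hbdd ⟨hy i, (hlt i).le⟩
    have hA : 0 ≤ ∑ i ∈ I, a i := Finset.sum_nonneg fun i _ => coeff_nonneg hlin hmono i
    have hg := apply_ite hlin I y x s
    rw [← hx] at hg
    have h₁ : s < g fun i => if i ∈ I then s else y i := by rw [hg]; nlinarith
    have h₂ : (g fun i => if i ∈ I then s else y i) ≤ x := by rw [hg]; nlinarith
    refine absurd (le_csSup hbdd ⟨apply_mem_closure hcont (fun i => ?_) fun i => ?_, h₂⟩)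
      h₁.not_ge
    · split_ifs
      exacts [hs.1, hy i]
    · split_ifs
      exacts [h₁, (hys i).trans_lt h₁]

theorem Generated.cases_single {x : ℝ} (h : Generated {⟨n, g⟩} P x) :
    x ∈ P ∨ ∃ y : Fin n → ℝ, (∀ i, Generated {⟨n, g⟩} P (y i)) ∧ (∀ i, y i < x) ∧ x = g y := by
  cases h with
  | base h => exact .inl h
  | @app k g' hg y hy hlt =>
    obtain ⟨rfl, h⟩ : k = n ∧ g' ≍ g := by
      simpa only [Set.mem_singleton_iff, Sigma.mk.injEq] using hg
    obtain rfl := eq_of_heq h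
    exact .inr ⟨y, hy, hlt, rfl⟩

theorem exists_fixedPoint_of_mem_closure (hlin : ∀ x, g x = ∑ i, a i * x i + b)
    (hmono : Monotone g) (hP : P.Finite) {x : ℝ} (hx : x ∈ closure (genSet {⟨n, g⟩} P))
    (hxP : x ∉ P) : ∃ I : Finset (Fin n), ∑ i ∈ I, a i < 1 ∧ ∃ y : Fin n → ℝ,
      (∀ i, y i ∈ closure (genSet {⟨n, g⟩} P)) ∧ (∀ i, y i < x) ∧
        x = g fun i => if i ∈ I then x else y i := by
  classical
  have hcont := continuous_of_affine hlin
  set F := genSet {⟨n, g⟩} P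
  have hx' : x ∈ closure (F ∩ Pᶜ) := by
    rw [Set.inter_comm]
    exact hP.isClosed.isOpen_compl.inter_closure ⟨hxP, hx⟩
  obtain ⟨s, hs, hsx⟩ := mem_closure_iff_seq_limit.1 hx'
  have (k : ℕ) := (Generated.cases_single (hs k).1).resolve_left (hs k).2
  choose y hyF hlt hsy using this
  have hpwo : (Set.univ.pi fun _ : Fin n => F).IsPWO :=
    Set.IsPWO.pi fun _ => Set.isPWO_iff_isWF.2 (isWF_genSet hmono hP)
  obtain ⟨φ, hφ⟩ := hpwo.exists_monotone_subseq (f := y) fun k i _ => hyF k i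
  have hsφ : Tendsto (fun k => s (φ k)) atTop (𝓝 x) := hsx.comp φ.strictMono.tendsto_atTop
  obtain ⟨B, hB⟩ := hsx.bddAbove_range
  have hbdd (i : Fin n) : BddAbove (Set.range fun k => y (φ k) i) := by
    refine ⟨B, ?_⟩
    rintro _ ⟨k, rfl⟩
    exact (hlt _ i).le.trans (hB ⟨_, rfl⟩)
  set z : Fin n → ℝ := fun i => ⨆ k, y (φ k) i
  have hyz (k : ℕ) : y (φ k) ≤ z := fun i => le_ciSup (hbdd i) k
  have hlim : Tendsto (fun k => y (φ k)) atTop (𝓝 z) :=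
    tendsto_pi_nhds.2 fun i => tendsto_atTop_ciSup (fun _ _ h => hφ h i) (hbdd i)
  have hgz : g z = x := by
    refine tendsto_nhds_unique ((hcont.tendsto z).comp hlim) (hsφ.congr fun k => hsy _)
  have hzx (i : Fin n) : z i ≤ x :=
    le_of_tendsto_of_tendsto' (tendsto_pi_nhds.1 hlim i) hsφ fun k => (hlt _ i).le
  have hzC (i : Fin n) : z i ∈ closure F :=
    mem_closure_of_tendsto (tendsto_pi_nhds.1 hlim i) (.of_forall fun k => hyF _ i)
  set I : Finset (Fin n) := Finset.univ.filter fun i => z i = x with hI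
  have hzI : z = fun i => if i ∈ I then x else z i := by
    funext i
    split_ifs with h
    · exact (Finset.mem_filter.1 h).2
    · rfl
  -- On `I` the fixed point equation ignores `y`; any elements of the closure below x serve there.
  refine ⟨I, ?_, fun i => if i ∈ I then y (φ 0) i else z i, fun i => ?_, fun i => ?_, ?_⟩
  -- With slope at least 1, moving down from x to the largest `I`-argument t of `y (φ 0)` lowers the
  -- value by at least x - t. So `s (φ 0)` ≤ t, although t is one of its arguments.
  · by_contra! hA
    have hne : I.Nonempty := by
      rw [Finset.nonempty_iff_ne_empty]
      intro h
      rw [h, Finset.sum_empty] at hA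
      exact absurd hA (by norm_num)
    obtain ⟨i, hi, hmax⟩ := I.exists_max_image (y (φ 0)) hne
    have hle : y (φ 0) ≤ fun j => if j ∈ I then y (φ 0) i else z j := by
      intro j
      dsimp only
      split_ifs with h
      exacts [hmax j h, hyz 0 j]
    have h₁ := hmono hle
    rw [apply_ite hlin I z x, ← hzI, hgz, ← hsy] at h₁
    have h₂ := hlt (φ 0) i
    have h₃ : y (φ 0) i ≤ x := (hyz 0 i).trans (hzx i)
    nlinarith
  · dsimp only
    split_ifs
    exacts [subset_closure (hyF _ i), hzC i]
  · dsimp only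
    split_ifs with h
    · calc y (φ 0) i < s (φ 0) := hlt _ i
        _ = g (y (φ 0)) := hsy _
        _ ≤ x := hgz ▸ hmono (hyz 0)
    · exact (hzx i).lt_of_ne fun h' => h (by simp [hI, h'])
  · refine hgz.symm.trans (congrArg g (hzI.trans (funext fun i => ?_)))
    split_ifs with h
    · rfl
    · exact (if_neg h).symm

/-- Each element of `D` belongs to `P` or is obtained from smaller elements of `D`, as a value or as
an attractive fixed point of `g`. -/
def IsDerivation (g : (Fin n → ℝ) → ℝ) (a : Fin n → ℝ) (P D : Set ℝ) : Prop :=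
  ∀ d ∈ D, d ∈ P ∨ ∃ I : Finset (Fin n), ∑ i ∈ I, a i < 1 ∧
    ∃ y : Fin n → ℝ, (∀ i, y i ∈ D) ∧ (∀ i, y i < d) ∧ d = g fun i => if i ∈ I then d else y i

theorem mem_closure_iff_exists_finite (hlin : ∀ x, g x = ∑ i, a i * x i + b)
    (hmono : Monotone g) (hP : P.Finite) (x : ℝ) : x ∈ closure (genSet {⟨n, g⟩} P) ↔
      ∃ D : Set ℝ, D.Finite ∧ x ∈ D ∧ IsDerivation g a P D := by
  constructor
  · intro hx
    have hwf := isWF_closure (isWF_genSet (g := g) hmono hP)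
    refine Set.WellFoundedOn.induction hwf hx (P := fun x => ∃ D : Set ℝ, D.Finite ∧ x ∈ D ∧ IsDerivation g a P D)
      fun x hx ih => ?_
    · by_cases hxP : x ∈ P
      · refine ⟨{x}, Set.finite_singleton x, rfl, ?_⟩
        rintro d rfl
        exact .inl hxP
      · obtain ⟨I, hI, y, hy, hlt, hxy⟩ := exists_fixedPoint_of_mem_closure hlin hmono hP hx hxP
        choose D hD hyD hDD using fun i => ih (y i) (hy i) (hlt i)
        refine ⟨insert x (⋃ i, D i), (Set.finite_iUnion hD).insert x, .inl rfl, ?_⟩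
        rintro d (rfl | hd)
        · exact .inr ⟨I, hI, y, fun i => .inr (Set.mem_iUnion.2 ⟨i, hyD i⟩), hlt, hxy⟩
        · obtain ⟨i, hi⟩ := Set.mem_iUnion.1 hd
          refine (hDD i d hi).imp_right ?_
          rintro ⟨J, hJ, z, hz, h⟩
          exact ⟨J, hJ, z, fun j => .inr (Set.mem_iUnion.2 ⟨i, hz j⟩), h⟩
  · rintro ⟨D, hD, hx, hDD⟩
    refine Set.WellFoundedOn.induction hD.isWF hx fun x hx ih => ?_
    · rcases hDD x hx with h | ⟨I, hI, y, hy, hlt, hxy⟩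
      · exact subset_closure (.base h)
      · exact fixedPoint_mem_closure hlin hmono hI (fun i => ih (y i) (hy i) (hlt i)) hlt hxy

end HF

namespace HF

open Filter Topology

variable {n : ℕ} {g : (Fin n → ℝ) → ℝ} {P : Set ℝ} {a : Fin n → ℝ} {b : ℝ}

/-! ### Gaps of the closure -/

/-- The points of `C` below `m` stay away from `m`. -/
def LeftIsolated (C : Set ℝ) (m : ℝ) : Prop := ∃ z < m, ∀ c ∈ C, c < m → c ≤ z

/-- Arguments from `C` below `m` at which `g` is at least `m` dominate such arguments from `M`. -/
def Covers (g : (Fin n → ℝ) → ℝ) (C M : Set ℝ) (m : ℝ) : Prop :=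
  ∀ u : Fin n → ℝ, (∀ i, u i ∈ C) → (∀ i, u i < m) → m ≤ g u →
    ∃ μ : Fin n → ℝ, (∀ i, μ i ∈ M) ∧ μ ≤ u ∧ m ≤ g μ

theorem Covers.mono {C M N : Set ℝ} {m : ℝ} (h : Covers g C M m) (hMN : M ⊆ N) :
    Covers g C N m := fun u hu hm hg =>
  let ⟨μ, hμ, h'⟩ := h u hu hm hg
  ⟨μ, fun i => hMN (hμ i), h'⟩

theorem LeftIsolated.exists_isGreatest {C : Set ℝ} (hC : IsClosed C) {m c : ℝ}
    (hm : LeftIsolated C m) (hc : c ∈ C) (hcm : c < m) : ∃ u, IsGreatest (C ∩ Set.Iio m) u := by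
  obtain ⟨z, hz, h⟩ := hm
  have hbdd : BddAbove (C ∩ Set.Iic z) := ⟨z, fun _ h => h.2⟩
  have hs := (hC.inter isClosed_Iic).csSup_mem ⟨c, hc, h c hc hcm⟩ hbdd
  exact ⟨_, ⟨hs.1, hs.2.trans_lt hz⟩, fun d hd => le_csSup hbdd ⟨hd.1, h d hd.1 hd.2⟩⟩

/-- The minimal tuples form a finite antichain. Lowering one coordinate inside C pushes the value
below m, hence across the gap left of m, which an arbitrarily small change cannot do. -/
theorem exists_finite_covers (hlin : ∀ x, g x = ∑ i, a i * x i + b) (hmono : Monotone g)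
    (hP : P.Finite) {m : ℝ} (hm : LeftIsolated (closure (genSet {⟨n, g⟩} P)) m) :
    ∃ B : Set ℝ, B.Finite ∧ (∀ d ∈ B, d ∈ closure (genSet {⟨n, g⟩} P) ∧ d < m ∧
      LeftIsolated (closure (genSet {⟨n, g⟩} P)) d) ∧
      Covers g (closure (genSet {⟨n, g⟩} P)) B m := by
  classical
  have hcont := continuous_of_affine hlin
  have hwf := isWF_closure (isWF_genSet (g := g) hmono hP)
  have hge := fun y m => exists_mem_closure_ge (P := P) (y := y) (m := m) hcont
  set C := closure (genSet {⟨n, g⟩} P)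
  set Z : Set (Fin n → ℝ) := {u | (∀ i, u i ∈ C) ∧ (∀ i, u i < m) ∧ m ≤ g u}
  have hZ : Z.IsPWO := by
    refine (Set.IsPWO.pi (s := fun _ : Fin n => C) fun _ => Set.isPWO_iff_isWF.2 hwf).mono ?_
    exact fun u hu i _ => hu.1 i
  set N : Set (Fin n → ℝ) := {u | Minimal (· ∈ Z) u}
  have hN : N.Finite := (setOfPred_minimal_antichain _).finite_of_partiallyWellOrderedOn
    (hZ.mono fun u hu => hu.prop)
  refine ⟨⋃ u ∈ N, Set.range u, hN.biUnion fun u _ => Set.finite_range u, ?_, ?_⟩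
  · intro d hd
    obtain ⟨μ, hμ, i, rfl⟩ : ∃ μ ∈ N, ∃ i, μ i = d := by simpa using hd
    obtain ⟨hμC, hμm, hμg⟩ := hμ.prop
    refine ⟨hμC i, hμm i, ?_⟩
    obtain ⟨z, hz, hzC⟩ := hm
    have ha := coeff_nonneg hlin hmono i
    -- Crossing the gap requires a i * (μ i - c) ≥ m - z; the added 1 keeps the denominator positive
    -- when a i = 0.
    refine ⟨μ i - (m - z) / (a i + 1), sub_lt_self _ (div_pos (sub_pos.2 hz) (by linarith)), ?_⟩
    intro c hc hci
    by_contra! hlt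
    have hle : Function.update μ i c ≤ μ := update_le_self_iff.2 hci.le
    have hC' (j : Fin n) : Function.update μ i c j ∈ C := by
      by_cases h : j = i
      · rw [h, Function.update_self]; exact hc
      · rw [Function.update_of_ne h]; exact hμC j
    have hm' (j : Fin n) : Function.update μ i c j < m := (hle j).trans_lt (hμm j)
    have hlt' : g (Function.update μ i c) < m := by
      by_contra! h
      have := hμ.le_of_le ⟨hC', hm', h⟩ hle i
      rw [Function.update_self] at this
      exact this.not_gt hci
    obtain ⟨c', hc', hcm, hgc, -⟩ := hge _ m hC' hm' hlt'
    have hz' := hgc.trans (hzC c' hc' hcm)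
    have hsum : g μ = g (Function.update μ i c) + a i * (μ i - c) := by
      have h₁ : Function.update μ i c = fun j => if j ∈ ({i} : Finset (Fin n)) then c else μ j := by
        funext j
        simp [Function.update_apply]
      have h₂ : μ = fun j => if j ∈ ({i} : Finset (Fin n)) then μ i else μ j := by
        funext j
        split_ifs with h
        exacts [congrArg μ (Finset.mem_singleton.1 h), rfl]
      rw [h₁, apply_ite hlin {i} μ (μ i) c, ← h₂, Finset.sum_singleton]
      ring
    have h₁ : (μ i - c) * (a i + 1) < m - z := by
      rw [← lt_div_iff₀ (by linarith)]
      linarith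
    nlinarith
  · intro u hu hum hug
    obtain ⟨μ, hμu, hμ⟩ := hZ.exists_le_minimal (a := u) ⟨hu, hum, hug⟩
    exact ⟨μ, fun i => Set.mem_biUnion hμ ⟨i, rfl⟩, hμu, hμ.prop.2.2⟩

theorem exists_finite_forall_covers (hlin : ∀ x, g x = ∑ i, a i * x i + b) (hmono : Monotone g)
    (hP : P.Finite) {C : Set ℝ} (hC : C = closure (genSet {⟨n, g⟩} P)) {m : ℝ}
    (hm : LeftIsolated C m) : ∃ M : Set ℝ, M.Finite ∧ (∀ d ∈ M, d ∈ C ∧ d < m) ∧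
      (∀ d ∈ insert m M, LeftIsolated C d ∧ Covers g C M d) ∧
      ∀ c ∈ C, c < m → ∃ d ∈ M, d ≤ c := by
  have hwf : C.IsWF := hC ▸ isWF_closure (isWF_genSet (g := g) hmono hP)
  set Q : ℝ → Prop := fun m => ∃ M : Set ℝ, M.Finite ∧ (∀ d ∈ M, d ∈ C ∧ d < m) ∧
      (∀ d ∈ insert m M, LeftIsolated C d ∧ Covers g C M d) ∧
      ∀ c ∈ C, c < m → ∃ d ∈ M, d ≤ c
  have step : ∀ m, LeftIsolated C m → (∀ c ∈ C, c < m → LeftIsolated C c → Q c) → Q m := by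
    intro m hm ih
    obtain ⟨B, hB, hBC, hcov⟩ := exists_finite_covers hlin hmono hP (hC ▸ hm)
    rw [← hC] at hBC hcov
    -- The least element of C is added so that every point of C below m has a cut at or below it.
    set B' : Set ℝ := B ∪ {c | IsLeast C c ∧ c < m}
    have hB' : B'.Finite := hB.union (Set.Subsingleton.finite fun c hc d hd => hc.1.unique hd.1)
    have hB'C : ∀ d ∈ B', d ∈ C ∧ d < m ∧ LeftIsolated C d := by
      rintro d (hd | hd)
      · exact hBC d hd
      · exact ⟨hd.1.1, hd.2, d - 1, by linarith, fun c hc hcd => absurd (hd.1.2 hc) hcd.not_ge⟩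
    choose! M hM hMC hMcov _ using fun d hd =>
      ih d (hB'C d hd).1 (hB'C d hd).2.1 (hB'C d hd).2.2
    have hsub (d : ℝ) (hd : d ∈ B') : insert d (M d) ⊆ ⋃ d ∈ B', insert d (M d) :=
      Set.subset_biUnion_of_mem (u := fun d => insert d (M d)) hd
    refine ⟨⋃ d ∈ B', insert d (M d), hB'.biUnion fun d hd => (hM d hd).insert d, ?_, ?_, ?_⟩
    · intro c hc
      obtain ⟨d, hd, hcd⟩ := Set.mem_iUnion₂.1 hc
      rcases hcd with rfl | hcd
      · exact ⟨(hB'C c hd).1, (hB'C c hd).2.1⟩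
      · exact ⟨(hMC d hd c hcd).1, (hMC d hd c hcd).2.trans (hB'C d hd).2.1⟩
    · rintro c (rfl | hc)
      · exact ⟨hm, hcov.mono fun d hd => hsub d (.inl hd) (.inl rfl)⟩
      · obtain ⟨d, hd, hcd⟩ := Set.mem_iUnion₂.1 hc
        exact ⟨(hMcov d hd c hcd).1,
          (hMcov d hd c hcd).2.mono ((Set.subset_insert _ _).trans (hsub d hd))⟩
    · intro c hc hcm
      have hle := hwf.min_le ⟨c, hc⟩ hc
      refine ⟨hwf.min ⟨c, hc⟩, hsub _ (.inr ⟨⟨hwf.min_mem _, fun d hd => hwf.min_le _ hd⟩,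
        hle.trans_lt hcm⟩) (.inl rfl), hle⟩
  have hall : ∀ c ∈ C, LeftIsolated C c → Q c := by
    intro c hc
    refine Set.WellFoundedOn.induction hwf hc (P := fun c => LeftIsolated C c → Q c)
      fun c hc ih => ?_
    exact fun h => step c h fun d hd hdc => ih d hd hdc
  exact step m hm fun c hc _ => hall c hc

/-! ### Interval certificates for non-membership -/

/-- A finite family of intervals outside of `x` that contains all generated elements below a number
larger than `x`. -/
theorem notMem_closure_of_intervals (hmono : Monotone g) {x w : ℝ} (hxw : x < w)
    {T : Set (ℝ × ℝ)} (hT : T.Finite) (hx : ∀ t ∈ T, x < t.1 ∨ t.2 < x)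
    (hP : ∀ p ∈ P, w ≤ p ∨ ∃ t ∈ T, t.1 ≤ p ∧ p ≤ t.2)
    (hg : ∀ t : Fin n → ℝ × ℝ, (∀ i, t i ∈ T) → w ≤ g (fun i => (t i).1) ∨
      ∃ s ∈ T, g (fun i => (t i).2) ≤ s.2 ∧ (s.1 ≤ g (fun i => (t i).1) ∨ ∃ i, s.1 ≤ (t i).1)) :
    x ∉ closure (genSet {⟨n, g⟩} P) := by
  have key : ∀ f, Generated {⟨n, g⟩} P f → f < w → ∃ t ∈ T, t.1 ≤ f ∧ f ≤ t.2 := by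
    intro f hf
    induction hf with
    | base h => exact fun hfw => (hP _ h).resolve_left hfw.not_ge
    | @app k g' hg' y hy hlt ih =>
      intro hfw
      obtain ⟨rfl, h⟩ : k = n ∧ g' ≍ g := by
        simpa only [Set.mem_singleton_iff, Sigma.mk.injEq] using hg'
      obtain rfl := eq_of_heq h
      choose t ht h₁ h₂ using fun i => ih i ((hlt i).trans hfw)
      have hle : g' (fun i => (t i).1) ≤ g' y := hmono h₁
      obtain ⟨s, hs, hu, hv⟩ := (hg t ht).resolve_left fun h => (h.trans hle).not_gt hfw
      refine ⟨s, hs, ?_, le_trans (hmono h₂) hu⟩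
      rcases hv with hv | ⟨i, hi⟩
      · exact hv.trans hle
      -- A generated value exceeds its arguments, so a lower bound of one argument suffices.
      · exact hi.trans ((h₁ i).trans (hlt i).le)
  intro hxC
  have hmem : x ∈ closure (Set.Iio w ∩ genSet {⟨n, g⟩} P) :=
    isOpen_Iio.inter_closure ⟨hxw, hxC⟩
  have hclosed : IsClosed (⋃ t ∈ T, Set.Icc t.1 t.2) := hT.isClosed_biUnion fun t _ => isClosed_Icc
  have hxT := closure_minimal (fun f hf => ?_) hclosed hmem
  · obtain ⟨t, ht, h₁, h₂⟩ := Set.mem_iUnion₂.1 hxT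
    rcases hx t ht with h | h
    exacts [h.not_ge h₁, h.not_ge h₂]
  · obtain ⟨t, ht, h⟩ := key f hf.2 hf.1
    exact Set.mem_biUnion ht h

theorem exists_intervals_of_notMem_closure (hlin : ∀ x, g x = ∑ i, a i * x i + b)
    (hmono : Monotone g) (hP : P.Finite) {x : ℝ} (hxC : x ∉ closure (genSet {⟨n, g⟩} P)) :
    ∃ w, x < w ∧ ∃ T : Set (ℝ × ℝ), T.Finite ∧ (∀ t ∈ T, t.1 ≤ t.2 ∧ t.2 < x) ∧
      (∀ p ∈ P, w ≤ p ∨ ∃ t ∈ T, t.1 ≤ p ∧ p ≤ t.2) ∧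
      ∀ t : Fin n → ℝ × ℝ, (∀ i, t i ∈ T) → w ≤ g (fun i => (t i).1) ∨
        ∃ s ∈ T, g (fun i => (t i).2) ≤ s.2 ∧
          (s.1 ≤ g (fun i => (t i).1) ∨ ∃ i, s.1 ≤ (t i).1) := by
  have hge := fun y m => exists_mem_closure_ge (P := P) (y := y) (m := m)
    (continuous_of_affine hlin)
  have hPC : P ⊆ closure (genSet {⟨n, g⟩} P) := fun p hp => subset_closure (.base hp)
  obtain ⟨C, hC⟩ : ∃ C, C = closure (genSet {⟨n, g⟩} P) := ⟨_, rfl⟩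
  have hCc : IsClosed C := hC ▸ isClosed_closure
  rw [← hC] at hxC hPC
  simp only [← hC] at hge
  obtain ⟨ε, hε, hball⟩ := Metric.isOpen_iff.1 hCc.isOpen_compl x hxC
  have hgap : ∀ c ∈ C, c < x + ε → c ≤ x - ε := by
    intro c hc hlt
    by_contra! h
    exact hball (show c ∈ Metric.ball x ε by
      rw [Metric.mem_ball, Real.dist_eq, abs_lt]; constructor <;> linarith) hc
  have hw : LeftIsolated C (x + ε) := ⟨x - ε, by linarith, hgap⟩
  set w := x + ε
  obtain ⟨M, hM, hMC, hMcov, hMle⟩ := exists_finite_forall_covers hlin hmono hP hC hw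
  -- The next cut is left-isolated, so C has a last point before it: the right end of the interval
  -- at `v`.
  have hnext : ∀ v ∈ M, ∃ m ∈ insert w M, ∃ u, v < m ∧ (∀ μ ∈ insert w M, v < μ → m ≤ μ) ∧
      IsGreatest (C ∩ Set.Iio m) u := by
    intro v hv
    obtain ⟨m, hm, hmin⟩ := Set.exists_min_image (insert w M ∩ Set.Ioi v) id
      ((hM.insert w).inter_of_left _) ⟨w, .inl rfl, (hMC v hv).2⟩
    obtain ⟨u, hu⟩ := (hMcov m hm.1).1.exists_isGreatest hCc (hMC v hv).1 hm.2
    exact ⟨m, hm.1, u, hm.2, fun μ hμ hvμ => hmin μ ⟨hμ, hvμ⟩, hu⟩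
  choose! nx hnx up hvnx hmin hup using hnext
  have hmax : ∀ c ∈ C, c < w → ∃ v ∈ M, v ≤ c ∧ c < nx v ∧ c ≤ up v := by
    intro c hc hcw
    obtain ⟨d, hd, hdc⟩ := hMle c hc hcw
    obtain ⟨v, hv, hvmax⟩ := Set.exists_max_image (M ∩ Set.Iic c) id (hM.inter_of_left _)
      ⟨d, hd, hdc⟩
    have hlt : c < nx v := by
      by_contra! h
      rcases hnx v hv.1 with h' | h'
      · exact (h' ▸ h).not_gt hcw
      · exact (hvmax _ ⟨h', h⟩).not_gt (hvnx v hv.1)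
    exact ⟨v, hv.1, hv.2, hlt, (hup v hv.1).2 ⟨hc, hlt⟩⟩
  have hnxw : ∀ v ∈ M, nx v ≤ w := fun v hv => hmin v hv w (.inl rfl) (hMC v hv).2
  refine ⟨w, by linarith, (fun v => (v, up v)) '' M, hM.image _, ?_, fun p hp => ?_, fun t ht => ?_⟩
  · rintro _ ⟨v, hv, rfl⟩
    refine ⟨(hup v hv).2 ⟨(hMC v hv).1, hvnx v hv⟩, ?_⟩
    have := hgap _ (hup v hv).1.1 ((hup v hv).1.2.trans_le (hnxw v hv))
    exact this.trans_lt (by linarith)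
  · refine (le_or_gt w p).imp_right fun h => ?_
    obtain ⟨v, hv, h₁, -, h₂⟩ := hmax p (hPC hp) h
    exact ⟨_, ⟨v, hv, rfl⟩, h₁, h₂⟩
  · choose v hv htv using ht
    obtain rfl : t = fun i => (v i, up (v i)) := funext fun i => (htv i).symm
    refine (le_or_gt w (g v)).imp_right fun h => ?_
    obtain ⟨c, hc, hcw, hgc, hvc, hcor⟩ := hge v w (fun i => (hMC _ (hv i)).1)
      (fun i => (hMC _ (hv i)).2) h
    obtain ⟨v', hv', h₁, hlt, -⟩ := hmax c hc hcw
    refine ⟨_, ⟨v', hv', rfl⟩, ?_, ?_⟩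
    · have hupC (i : Fin n) : up (v i) ∈ C := (hup _ (hv i)).1.1
      have hupnx (i : Fin n) : up (v i) < nx v' := (hup _ (hv i)).1.2.trans_le
        (hmin _ (hv i) _ (hnx v' hv') ((hvc i).trans_lt hlt))
      have hgup : g (fun i => up (v i)) < nx v' := by
        -- Otherwise some μ from `M` below the right ends already reaches the next cut. As no cut
        -- lies strictly between `v i` and `up (v i)` or equals the latter unless it is `v i`, μ ≤
        -- v, so g v would reach that cut as well.
        by_contra! hle
        obtain ⟨μ, hμ, hμu, hgμ⟩ := (hMcov _ (hnx v' hv')).2 _ hupC hupnx hle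
        have hμv : μ ≤ v := by
          intro i
          by_contra! h'
          exact ((hmin _ (hv i) _ (.inr (hμ i)) h').trans (hμu i)).not_gt (hup _ (hv i)).1.2
        exact (hgμ.trans ((hmono hμv).trans hgc)).not_gt hlt
      obtain ⟨c', hc', hcn, hgc', -⟩ := hge _ _ hupC hupnx hgup
      exact hgc'.trans ((hup v' hv').2 ⟨hc', hcn⟩)
    · rcases hcor with rfl | ⟨i, rfl⟩
      exacts [.inl h₁, .inr ⟨i, h₁⟩]

end HF

namespace HF

variable {n m : ℕ} {g : (Fin n → ℝ) → ℝ} {P : Set ℝ} {a : Fin n → ℝ} {b : ℝ} {A : Set ℝ}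

/-! ### The defining formulas -/

theorem sigFun_affine (hlin : ∀ x, g x = ∑ i, a i * x i + b) (ha : ∀ i, a i ∈ A) (hb : b ∈ A)
    {u : Fin n → Ctx m → ℝ} (hu : ∀ i, SigFun A (u i)) : SigFun A fun c => g fun i => u i c := by
  simp only [hlin]
  exact (SigFun.sum fun i => (sigFun_param (ha i)).mul (hu i)).add (sigFun_param hb)

theorem sigmaDefinable_closure (hlin : ∀ x, g x = ∑ i, a i * x i + b) (hmono : Monotone g)
    (hP : P.Finite) (ha : ∀ i, a i ∈ A) (hb : b ∈ A) (hPA : P ⊆ A) :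
    SigmaDefinable A (closure (genSet {⟨n, g⟩} P)) := by
  have hsig : Sig A fun c : Ctx 0 => ∃ D, Mem c.1 D ∧ ∀ d, Mem d D → ((∃ p ∈ P, val d = p) ∨
      ∃ I ∈ {I : Finset (Fin n) | ∑ i ∈ I, a i < 1}, ∃ y : Fin n → HF ℝ,
        ((∀ i, Mem (y i) D) ∧ ∀ i, val (y i) < val d) ∧
          val d = g fun i => if i ∈ I then val d else val (y i)) := by
    refine Sig.ex (Sig.and (sig_mem (isProj_init isVar_arg) isVar_last)
      (Sig.ball isVar_last (Sig.or ?_ ?_)))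
    · exact Sig.exists_finite hP fun p hp =>
        (sigFun_val isVar_last).eq (sigFun_param (hPA hp))
    -- The slope condition is not part of the formula: the disjunction runs over the finitely many
    -- `I` that satisfy it.
    · refine Sig.exists_finite (Set.toFinite _) fun I _ => Sig.exists_tuple fun m e y he hy => ?_
      have hd := sigFun_val (he isVar_last)
      refine Sig.and (Sig.and (Sig.forall_fin fun i => ?_) (Sig.forall_fin fun i => ?_)) ?_
      · exact sig_mem (hy i) (he (isProj_init isVar_last))
      · exact (sigFun_val (hy i)).lt hd
      · refine hd.eq (sigFun_affine hlin ha hb fun i => ?_)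
        split_ifs
        exacts [hd, sigFun_val (hy i)]
  refine hsig.sigmaDefinable fun x => ?_
  dsimp only
  rw [mem_closure_iff_exists_finite hlin hmono hP]
  constructor
  · rintro ⟨D, hD, hx, h⟩
    obtain ⟨D', hD'⟩ := exists_mem_iff (hD.image atom)
    refine ⟨D', (hD' _).2 ⟨x, hx, rfl⟩, fun d hd => ?_⟩
    obtain ⟨d, hdD, rfl⟩ := (hD' _).1 hd
    rw [val_atom]
    rcases h d hdD with h | ⟨I, hI, y, hy, hlt, hdy⟩
    · exact .inl ⟨d, h, rfl⟩
    · refine .inr ⟨I, hI, fun i => atom (y i), ⟨fun i => (hD' _).2 ⟨_, hy i, rfl⟩, fun i => ?_⟩, ?_⟩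
      · simpa only [val_atom] using hlt i
      · simpa only [val_atom] using hdy
  · rintro ⟨D, hx, h⟩
    -- Members of `D` that are sets are harmless: they count as the real 0.
    refine ⟨val '' {z | Mem z D}, (finite_setOf_mem D).image _, ⟨_, hx, val_atom x⟩, ?_⟩
    rintro _ ⟨d, hd, rfl⟩
    rcases h d hd with ⟨p, hp, h⟩ | ⟨I, hI, y, ⟨hy, hlt⟩, hdy⟩
    · exact .inl (h ▸ hp)
    · exact .inr ⟨I, hI, fun i => val (y i), fun i => ⟨_, hy i, rfl⟩, hlt, hdy⟩

/-- Some member of `T` contains `v` and `u`. -/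
def IsPairIn (T v u : HF ℝ) : Prop := ∃ t, Mem t T ∧ Mem v t ∧ Mem u t

theorem sig_isPairIn {T v u : Ctx m → HF ℝ} (hT : IsVar A T) (hv : IsVar A v) (hu : IsVar A u) :
    Sig A fun c => IsPairIn (T c) (v c) (u c) :=
  Sig.ex ((sig_mem isVar_last (isProj_init hT)).and ((sig_mem (isProj_init hv) isVar_last).and
    (sig_mem (isProj_init hu) isVar_last)))

theorem finite_setOf_isPairIn (T : HF ℝ) :
    {t : ℝ × ℝ | ∃ v u, IsPairIn T v u ∧ t = (val v, val u)}.Finite := by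
  refine ((finite_setOf_mem T).biUnion fun t _ =>
    ((finite_setOf_mem t).image val).prod ((finite_setOf_mem t).image val)).subset ?_
  rintro _ ⟨v, u, ⟨t, ht, hv, hu⟩, rfl⟩
  exact Set.mem_biUnion ht ⟨⟨v, hv, rfl⟩, u, hu, rfl⟩

/-- Intervals are coded by unordered pairs of endpoints, so reversed and degenerate intervals appear
too. -/
theorem exists_isPairIn_iff {S : Set (ℝ × ℝ)} (hS : S.Finite) : ∃ T : HF ℝ,
    ∀ v u, IsPairIn T v u ↔ ∃ s ∈ S, (v = atom s.1 ∨ v = atom s.2) ∧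
      (u = atom s.1 ∨ u = atom s.2) := by
  choose t ht using fun s : ℝ × ℝ => exists_mem_iff (α := ℝ)
    ((Set.finite_singleton (atom s.2)).insert (atom s.1))
  obtain ⟨T, hT⟩ := exists_mem_iff (hS.image t)
  refine ⟨T, fun v u => ⟨?_, ?_⟩⟩
  · rintro ⟨z, hz, hv, hu⟩
    obtain ⟨s, hs, rfl⟩ := (hT z).1 hz
    exact ⟨s, hs, (ht s v).1 hv, (ht s u).1 hu⟩
  · rintro ⟨s, hs, hv, hu⟩
    exact ⟨t s, (hT _).2 ⟨s, hs, rfl⟩, (ht s v).2 hv, (ht s u).2 hu⟩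

theorem forall_isPairIn_iff {T : HF ℝ} {R : (Fin n → HF ℝ) → (Fin n → HF ℝ) → Prop} :
    (∀ t : Fin n → HF ℝ, (∀ i, Mem (t i) T) → ∀ v : Fin n → HF ℝ, (∀ i, Mem (v i) (t i)) →
      ∀ u : Fin n → HF ℝ, (∀ i, Mem (u i) (t i)) → R v u) ↔
      ∀ v u, (∀ i, IsPairIn T (v i) (u i)) → R v u := by
  constructor
  · intro h v u hvu
    choose t ht hv hu using hvu
    exact h t ht v hv u hu
  · exact fun h t ht v hv u hu => h v u fun i => ⟨t i, ht i, hv i, hu i⟩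

theorem sigmaDefinable_compl_closure (hlin : ∀ x, g x = ∑ i, a i * x i + b) (hmono : Monotone g)
    (hP : P.Finite) (ha : ∀ i, a i ∈ A) (hb : b ∈ A) (hPA : P ⊆ A) :
    SigmaDefinable A (closure (genSet {⟨n, g⟩} P))ᶜ := by
  have hsig : Sig A fun c : Ctx 0 => ∃ w, val c.1 < val w ∧ ∃ T,
      ((∀ t, Mem t T → ∀ v, Mem v t → ∀ u, Mem u t → (val c.1 < val v ∨ val u < val c.1)) ∧
      (∀ p ∈ P, val w ≤ p ∨ ∃ v u, IsPairIn T v u ∧ (val v ≤ p ∧ p ≤ val u)) ∧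
      (∀ t : Fin n → HF ℝ, (∀ i, Mem (t i) T) → ∀ v : Fin n → HF ℝ, (∀ i, Mem (v i) (t i)) →
        ∀ u : Fin n → HF ℝ, (∀ i, Mem (u i) (t i)) → (val w ≤ g (fun i => val (v i)) ∨
          ∃ v' u', IsPairIn T v' u' ∧ (g (fun i => val (u i)) ≤ val u' ∧
            (val v' ≤ g (fun i => val (v i)) ∨ ∃ i, val v' ≤ val (v i)))))) := by
    refine Sig.ex (Sig.and ((sigFun_val (isProj_init isVar_arg)).lt (sigFun_val isVar_last))
      (Sig.ex (Sig.and ?_ (Sig.and ?_ ?_))))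
    · refine Sig.ball isVar_last (Sig.ball isVar_last (Sig.ball (isProj_init isVar_last) ?_))
      -- The five bound variables are w, T, t, v, u.
      have hx := sigFun_val (A := A) (n := 5) isVar_arg
      exact (hx.lt (sigFun_val (isProj_init isVar_last))).or ((sigFun_val isVar_last).lt hx)
    · refine Sig.forall_finite hP fun p hp => ?_
      have hp' {k : ℕ} := sigFun_param (n := k) (hPA hp)
      refine Sig.or ((sigFun_val (isProj_init isVar_last)).le hp') (Sig.ex (Sig.ex ?_))
      exact (sig_isPairIn (isProj_init (isProj_init isVar_last)) (isProj_init isVar_last)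
        isVar_last).and (((sigFun_val (isProj_init isVar_last)).le hp').and
          (hp'.le (sigFun_val isVar_last)))
    · refine Sig.ball_tuple (fun _ => isVar_last) fun m e t he ht => ?_
      refine Sig.ball_tuple ht fun m₁ e₁ v he₁ hv => ?_
      refine Sig.ball_tuple (fun i => he₁ (ht i)) fun m₂ e₂ u he₂ hu => ?_
      have hv' (i : Fin n) := sigFun_val (he₂ (hv i))
      have he' := he.comp (he₁.comp he₂)
      refine Sig.or ((sigFun_val (he' (isProj_init isVar_last))).le
        (sigFun_affine hlin ha hb hv')) (Sig.ex (Sig.ex (Sig.and ?_ (Sig.and ?_ (Sig.or ?_ ?_)))))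
      · exact sig_isPairIn (isProj_init (isProj_init (he' isVar_last)))
          (isProj_init isVar_last) isVar_last
      · exact (sigFun_affine hlin ha hb fun i => sigFun_val (isProj_init (isProj_init (hu i)))).le
          (sigFun_val isVar_last)
      · exact (sigFun_val (isProj_init isVar_last)).le (sigFun_affine hlin ha hb fun i =>
          (hv' i).proj (isProj_init.comp isProj_init))
      · exact Sig.exists_fin fun i => (sigFun_val (isProj_init isVar_last)).le
          ((hv' i).proj (isProj_init.comp isProj_init))
  refine hsig.sigmaDefinable fun x => ?_
  simp only [val_atom, forall_isPairIn_iff]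
  constructor
  · intro hx
    obtain ⟨w, hxw, S, hS, hSx, hSP, hSg⟩ := exists_intervals_of_notMem_closure hlin hmono hP hx
    obtain ⟨T, hT⟩ := exists_isPairIn_iff hS
    have hpair (s : ℝ × ℝ) (hs : s ∈ S) : IsPairIn T (atom s.1) (atom s.2) :=
      (hT _ _).2 ⟨s, hs, .inl rfl, .inr rfl⟩
    -- Each spurious interval lies inside a genuine one, so by monotonicity it satisfies the same
    -- conditions.
    have hval (v u : HF ℝ) (h : IsPairIn T v u) : ∃ s ∈ S, s.1 ≤ val v ∧ val u ≤ s.2 := by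
      obtain ⟨s, hs, hv, hu⟩ := (hT v u).1 h
      refine ⟨s, hs, ?_, ?_⟩
      · rcases hv with rfl | rfl <;> simp [(hSx s hs).1]
      · rcases hu with rfl | rfl <;> simp [(hSx s hs).1]
    refine ⟨atom w, by simpa using hxw, T, ?_, fun p hp => ?_, fun v u hvu => ?_⟩
    · intro t ht v hv u hu
      obtain ⟨s, hs, -, h⟩ := hval v u ⟨t, ht, hv, hu⟩
      exact .inr (h.trans_lt (hSx s hs).2)
    · rw [val_atom]
      refine (hSP p hp).imp_right ?_
      rintro ⟨s, hs, h⟩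
      exact ⟨_, _, hpair s hs, by simpa only [val_atom] using h⟩
    · choose s hs hv hu using fun i => hval _ _ (hvu i)
      have hgv : g (fun i => (s i).1) ≤ g fun i => val (v i) := hmono hv
      have hgu : (g fun i => val (u i)) ≤ g fun i => (s i).2 := hmono hu
      rw [val_atom]
      refine (hSg s hs).imp (fun h => h.trans hgv) ?_
      rintro ⟨r, hr, h₁, h₂⟩
      refine ⟨_, _, hpair r hr, ?_⟩
      simp only [val_atom]
      exact ⟨hgu.trans h₁, h₂.imp (fun h => h.trans hgv) fun ⟨i, hi⟩ => ⟨i, hi.trans (hv i)⟩⟩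
  · rintro ⟨w, hxw, T, hTx, hTP, hTg⟩
    refine notMem_closure_of_intervals hmono hxw (finite_setOf_isPairIn T) ?_ ?_ ?_
    · rintro _ ⟨v, u, ⟨t, ht, hv, hu⟩, rfl⟩
      exact hTx t ht v hv u hu
    · intro p hp
      refine (hTP p hp).imp_right ?_
      rintro ⟨v, u, h, h'⟩
      exact ⟨_, ⟨v, u, h, rfl⟩, h'⟩
    · intro t ht
      choose v u hvu ht using ht
      obtain rfl : t = fun i => (val (v i), val (u i)) := funext ht
      refine (hTg v u hvu).imp_right ?_
      rintro ⟨v', u', h, h'⟩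
      exact ⟨_, ⟨v', u', h, rfl⟩, h'⟩

end HF

theorem theorem4 (n : ℕ) (g : (Fin n → ℝ) → ℝ) (a : Fin n → ℝ) (b : ℝ)
    (hlin : ∀ x, g x = ∑ i, a i * x i + b) (hmono : Monotone g)
    (P : Set ℝ) (hP : P.Finite) :
    HF.Decides (Set.range a ∪ {b} ∪ P) (closure (genSet {⟨n, g⟩} P)) := by
  have ha (i : Fin n) : a i ∈ Set.range a ∪ {b} ∪ P := .inl (.inl ⟨i, rfl⟩)
  have hb : b ∈ Set.range a ∪ {b} ∪ P := .inl (.inr rfl)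
  have hPA : P ⊆ Set.range a ∪ {b} ∪ P := Set.subset_union_right
  exact ⟨HF.sigmaDefinable_closure hlin hmono hP ha hb hPA,
    HF.sigmaDefinable_compl_closure hlin hmono hP ha hb hPA⟩
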